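/- Let $0<\gamma<1$, $0<\alpha<1$, $\pi\in[0,1]$, and let $f_0,f_1$ be probability densities on $\mathbb{R}$. For every $m$ let $(\theta_i,Z_i)$, $i=1,\dots,m$, be i.i.d. from the two-group model: $\theta_i\sim\mathrm{Bernoulli}(\pi)$ and, given $\theta_i$, $Z_i$ has density $(1-\theta_i)f_0+\theta_i f_1$ ($\theta_i=0$ means that the $i$-th null hypothesis is true). Let $f=(1-\pi)f_0+\pi f_1$ and let $\mathrm{lfdr}(z)=(1-\pi)f_0(z)/f(z)$ be the local false discovery rate. Assume that $\mathbb{P}(\mathrm{lfdr}(Z_1)<\gamma)>0$. Let $T_i=T_{m,i}(Z_1,\dots,Z_m)\in[0,1]$, $i\le m$, be estimates of $\mathrm{lfdr}(Z_i)$ computed from the data which are consistent, that is, $\max_{i\le m}\mathbb{P}(|T_i-\mathrm{lfdr}(Z_i)|\ge\delta)\to0$ as $m\to\infty$ for every $\delta>0$. The data-driven procedure ranks the estimates, $T_{(1)}\le\dots\le T_{(m)}$ (ties broken in any way depending on the data), and rejects the $K$ hypotheses with the smallest estimates, where $K$ is the largest $k\in\{0,\dots,m\}$ such that $\mathbb{P}(\mathrm{PBD}(k;T_{(1)},\dots,T_{(k)})>\gamma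 k)\le\alpha$; here $\mathrm{PBD}(k;p_1,\dots,p_k)$ is the Poisson binomial distribution, i.e. the law of the sum of $k$ independent Bernoulli variables with success probabilities $p_1,\dots,p_k$ (for the estimates regarded as fixed numbers). Let $\mathrm{FDP}_m$ be the number of rejected $i$ with $\theta_i=0$ divided by $\max(K,1)$. Then for every $\varepsilon>0$, $$\mathbb{P}(\mathrm{FDP}_m\ge\gamma+\varepsilon)\le\alpha+o(1)\qquad(m\to\infty).$$ -/

import Mathlib

open MeasureTheory ProbabilityTheory Filter Topology

namespace FDX

noncomputable section

/-- `f` is a probability density on the real line with respect to Lebesgue measure. -/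
structure IsDensity (f : ℝ → ℝ) : Prop where
  measurable : Measurable f
  nonneg : ∀ z, 0 ≤ f z
  lintegral_eq_one : ∫⁻ z, ENNReal.ofReal (f z) = 1

/-- The probability distribution on the real line with density `f`. -/
def densityLaw (f : ℝ → ℝ) : Measure ℝ :=
  volume.withDensity fun z => ENNReal.ofReal (f z)

/-- The mixture density `f = (1 - π) f₀ + π f₁`. -/
def mixtureDensity (π : ℝ) (f₀ f₁ : ℝ → ℝ) (z : ℝ) : ℝ :=
  (1 - π) * f₀ z + π * f₁ z

/-- The local false discovery rate `(1 - π) f₀(z) / f(z)`. -/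
def lfdr (π : ℝ) (f₀ f₁ : ℝ → ℝ) (z : ℝ) : ℝ :=
  (1 - π) * f₀ z / mixtureDensity π f₀ f₁ z

/-- The joint law of a pair `(θ, Z)` in the two-group model: `θ` is Bernoulli with
`P(θ = true) = π`, and given `θ` the variable `Z` has density `f₀` if `θ = false` (null hypothesis
true) and density `f₁` if `θ = true` (alternative true). -/
def twoGroupLaw (π : ℝ) (f₀ f₁ : ℝ → ℝ) : Measure (Bool × ℝ) :=
  ENNReal.ofReal (1 - π) • (Measure.dirac false).prod (densityLaw f₀) +
    ENNReal.ofReal π • (Measure.dirac true).prod (densityLaw f₁)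

/-- The pairs `(θ i, Z i)` are independent and identically distributed according to the two-group
model. The value `θ i = false` means that the `i`-th null hypothesis is true. -/
structure IsTwoGroupSample {Ω ι : Type*} [MeasurableSpace Ω] (P : Measure Ω)
    (π : ℝ) (f₀ f₁ : ℝ → ℝ) (θ : ι → Ω → Bool) (Z : ι → Ω → ℝ) : Prop where
  measurable_theta : ∀ i, Measurable (θ i)
  measurable_Z : ∀ i, Measurable (Z i)
  indep : iIndepFun (fun i ω => (θ i ω, Z i ω)) P
  law : ∀ i, P.map (fun ω => (θ i ω, Z i ω)) = twoGroupLaw π f₀ f₁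

/-- The point mass at `j` of the Poisson binomial distribution with success probabilities
`p i`, `i ∈ S`, that is, of the number of successes in independent Bernoulli trials. -/
def poissonBinomialMass {ι : Type*} [DecidableEq ι] (S : Finset ι) (p : ι → ℝ) (j : ℕ) : ℝ :=
  ∑ A ∈ S.powersetCard j, (∏ i ∈ A, p i) * ∏ i ∈ S \ A, (1 - p i)

open Classical in
/-- The probability that a Poisson binomial variable with success probabilities `p i`, `i ∈ S`,
is strictly larger than `x`. -/
def poissonBinomialTail {ι : Type*} [DecidableEq ι] (S : Finset ι) (p : ι → ℝ) (x : ℝ) : ℝ :=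
  ∑ j ∈ (Finset.range (S.card + 1)).filter (fun j : ℕ => x < (j : ℝ)), poissonBinomialMass S p j

/-- `σ` ranks the statistics `t` in ascending order; `σ j` is the index of the `j`-th smallest
statistic (counting from `0`). Ties may be broken in any way. -/
def IsRanking {m : ℕ} (t : Fin m → ℝ) (σ : Equiv.Perm (Fin m)) : Prop :=
  Monotone (t ∘ σ)

/-- The indices of the first `k` hypotheses along the ranking `σ`. -/
def topSet {m : ℕ} (σ : Equiv.Perm (Fin m)) (k : ℕ) : Finset (Fin m) :=
  Finset.univ.filter fun i => (σ.symm i : ℕ) < k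

open Classical in
/-- The number of rejections: the largest `k ∈ {0, …, m}` such that the Poisson binomial
distribution of the `k` top ranked statistics gives mass at most `α` to values above `γ k`
(which holds for `k = 0` if `0 ≤ α`). -/
def numRejections {m : ℕ} (γ α : ℝ) (t : Fin m → ℝ) (σ : Equiv.Perm (Fin m)) : ℕ :=
  Nat.findGreatest (fun k => poissonBinomialTail (topSet σ k) t (γ * k) ≤ α) m

/-- The set of rejected hypotheses. -/
def rejectionSet {m : ℕ} (γ α : ℝ) (t : Fin m → ℝ) (σ : Equiv.Perm (Fin m)) : Finset (Fin m) :=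
  topSet σ (numRejections γ α t σ)

/-- The false discovery proportion of the rejection set `S` when the true states are `θ`. -/
def fdp {m : ℕ} (θ : Fin m → Bool) (S : Finset (Fin m)) : ℝ :=
  ((S.filter fun i => θ i = false).card : ℝ) / max (S.card : ℝ) 1

/-- Consistency of the estimates `T m (Z) i` of the local false discovery rates `lfdr (Z i)`:
the estimation error tends to zero in probability as the number `m` of hypotheses grows,
uniformly over the index `i` of the hypothesis. -/
def IsConsistentLfdr {Ω : ℕ → Type*} [∀ m, MeasurableSpace (Ω m)] (P : ∀ m, Measure (Ω m))
    (π : ℝ) (f₀ f₁ : ℝ → ℝ) (Z : ∀ m, Fin m → Ω m → ℝ)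
    (T : ∀ m, (Fin m → ℝ) → Fin m → ℝ) : Prop :=
  ∀ δ : ℝ, 0 < δ →
    Tendsto
      (fun m => ⨆ i : Fin m,
        P m {ω | δ ≤ |T m (fun j => Z m j ω) i - lfdr π f₀ f₁ (Z m i ω)|})
      atTop (𝓝 0)

end

end FDX

/-! More is true than claimed: for fixed `α` in `(0, 1)` the probability that the FDP is at least `γ
+ ε` tends to `0`. A Poisson binomial variable with `k` trials concentrates around its mean within
`O(√k)`, so once `K` is of order `m`, the constraint defining `K` forces the mean of the rejected
estimates to be at most `γ + o(1)`, whatever `α` is (`sum_rejectionSet_le`).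

`K` is of order `m` with high probability: some `γ' < γ` has `p = P(lfdr < γ') > 0`, so a positive
fraction of the estimates lies well below `γ`, and rejecting just those satisfies the constraint
(`card_filter_le_numRejections`).

Two replacements then cost `o(m)`, hence `o(K)`. Estimates become true lfdr values by consistency
and Markov's inequality. Sums of lfdr values become counts of true nulls because the rejection set
depends on the `Z i` only: given the data, the excesses of the null indicators have mean zero and
are independent, so their sum over the rejection set has second moment at most `m`
(`IsTwoGroupSample.measureReal_le_abs_sum_nullExcess`). `fdp_rejectionSet_lt` combines these bounds
outside three rare events. -/

namespace FDX

/-- The probability that, among independent trials `i ∈ S` with success probabilities `p i`,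
exactly those in `A` succeed. -/
def successWeight {ι : Type*} [DecidableEq ι] (S : Finset ι) (p : ι → ℝ) (A : Finset ι) : ℝ :=
  (∏ i ∈ A, p i) * ∏ i ∈ S \ A, (1 - p i)

/-! ### Concentration of the Poisson binomial distribution. -/

section PoissonBinomial

theorem sum_mul_one_sub_le_card {ι : Type*} (S : Finset ι) {p : ι → ℝ} (hp : ∀ i, p i ∈ Set.Icc (0 : ℝ) 1) :
    ∑ i ∈ S, p i * (1 - p i) ≤ S.card := by
  have : ∑ i ∈ S, p i * (1 - p i) ≤ ∑ _i ∈ S, (1 : ℝ) :=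
    Finset.sum_le_sum fun i _ => by nlinarith [(hp i).1, (hp i).2]
  simpa using this

variable {ι : Type*} [DecidableEq ι]

theorem sum_successWeight (S : Finset ι) (p : ι → ℝ) :
    ∑ A ∈ S.powerset, successWeight S p A = 1 := by
  have h := Finset.prod_add p (fun i => 1 - p i) S
  simp only [add_sub_cancel, Finset.prod_const_one] at h
  exact h.symm

theorem successWeight_nonneg {S : Finset ι} {p : ι → ℝ} (hp : ∀ i, p i ∈ Set.Icc (0 : ℝ) 1)
    (A : Finset ι) : 0 ≤ successWeight S p A :=
  mul_nonneg (Finset.prod_nonneg fun i _ => (hp i).1)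
    (Finset.prod_nonneg fun i _ => sub_nonneg.2 (hp i).2)

/-- Variance plus squared bias. The centre `c` is arbitrary for the induction: a success of the
inserted trial shifts it to `c - 1`. -/
theorem sum_successWeight_mul_sq (S : Finset ι) (p : ι → ℝ) (c : ℝ) :
    ∑ A ∈ S.powerset, successWeight S p A * ((A.card : ℝ) - c) ^ 2 =
      ∑ i ∈ S, p i * (1 - p i) + (∑ i ∈ S, p i - c) ^ 2 := by
  induction S using Finset.induction_on generalizing c with
  | empty => simp [successWeight]
  | insert a S ha ih =>
    rw [Finset.sum_powerset_insert ha, Finset.sum_insert ha, Finset.sum_insert ha]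
    have h1 : ∀ A ∈ S.powerset, successWeight (insert a S) p A * ((A.card : ℝ) - c) ^ 2 =
        (1 - p a) * (successWeight S p A * ((A.card : ℝ) - c) ^ 2) := by
      intro A hA
      have hAS := Finset.mem_powerset.1 hA
      have haA : a ∉ A := fun h => ha (hAS h)
      have : insert a S \ A = insert a (S \ A) := Finset.insert_sdiff_of_notMem _ haA
      rw [successWeight, successWeight, this, Finset.prod_insert (by simp [ha])]
      ring
    have h2 : ∀ A ∈ S.powerset,
        successWeight (insert a S) p (insert a A) * (((insert a A).card : ℝ) - c) ^ 2 =
        p a * (successWeight S p A * ((A.card : ℝ) - (c - 1)) ^ 2) := by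
      intro A hA
      have hAS := Finset.mem_powerset.1 hA
      have haA : a ∉ A := fun h => ha (hAS h)
      have : insert a S \ insert a A = S \ A := by
        ext x
        simp only [Finset.mem_sdiff, Finset.mem_insert]
        constructor
        · tauto
        · rintro ⟨h, h'⟩
          refine ⟨Or.inr h, ?_⟩
          rintro (rfl | h'')
          · exact ha h
          · exact h' h''
      rw [successWeight, successWeight, this, Finset.prod_insert haA,
        Finset.card_insert_of_notMem haA]
      push_cast
      ring
    rw [Finset.sum_congr rfl h1, Finset.sum_congr rfl h2, ← Finset.mul_sum, ← Finset.mul_sum,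
      ih, ih]
    ring

open Classical in
-- Summing over success sets instead of counts makes the second moment identity applicable to tails.
theorem poissonBinomialTail_eq (S : Finset ι) (p : ι → ℝ) (x : ℝ) :
    poissonBinomialTail S p x =
      ∑ A ∈ S.powerset, if x < (A.card : ℝ) then successWeight S p A else 0 := by
  rw [Finset.sum_powerset, poissonBinomialTail, Finset.sum_filter]
  refine Finset.sum_congr rfl fun j _ => ?_
  have : ∀ A ∈ S.powersetCard j, (if x < (A.card : ℝ) then successWeight S p A else 0) =
      if x < (j : ℝ) then successWeight S p A else 0 := fun A hA => by
    rw [(Finset.mem_powersetCard.1 hA).2]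
  rw [Finset.sum_congr rfl this]
  split_ifs
  · rfl
  · simp

/-- Chebyshev's inequality for the upper tail of a Poisson binomial distribution. -/
theorem poissonBinomialTail_le {S : Finset ι} {p : ι → ℝ} (hp : ∀ i, p i ∈ Set.Icc (0 : ℝ) 1)
    {x d : ℝ} (hd : 0 < d) (h : ∑ i ∈ S, p i + d ≤ x) :
    poissonBinomialTail S p x ≤ S.card / d ^ 2 := by
  classical
  rw [poissonBinomialTail_eq, le_div_iff₀ (by positivity), Finset.sum_mul]
  calc _ ≤ ∑ A ∈ S.powerset, successWeight S p A * ((A.card : ℝ) - ∑ i ∈ S, p i) ^ 2 := by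
        refine Finset.sum_le_sum fun A _ => ?_
        have hw := successWeight_nonneg (S := S) hp A
        split_ifs with hA
        · exact mul_le_mul_of_nonneg_left (pow_le_pow_left₀ hd.le (by linarith) 2) hw
        · rw [zero_mul]; positivity
    _ ≤ S.card := by
        rw [sum_successWeight_mul_sq, sub_self]
        simpa using sum_mul_one_sub_le_card S hp

/-- Chebyshev's inequality for the lower tail of a Poisson binomial distribution. -/
theorem one_sub_poissonBinomialTail_le {S : Finset ι} {p : ι → ℝ}
    (hp : ∀ i, p i ∈ Set.Icc (0 : ℝ) 1) {x d : ℝ} (hd : 0 < d) (h : x + d ≤ ∑ i ∈ S, p i) :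
    1 - poissonBinomialTail S p x ≤ S.card / d ^ 2 := by
  classical
  rw [poissonBinomialTail_eq, ← sum_successWeight S p, ← Finset.sum_sub_distrib,
    le_div_iff₀ (by positivity), Finset.sum_mul]
  calc _ ≤ ∑ A ∈ S.powerset, successWeight S p A * ((A.card : ℝ) - ∑ i ∈ S, p i) ^ 2 := by
        refine Finset.sum_le_sum fun A _ => ?_
        have hw := successWeight_nonneg (S := S) hp A
        split_ifs with hA
        · rw [sub_self, zero_mul]; positivity
        · rw [sub_zero]
          refine mul_le_mul_of_nonneg_left ?_ hw
          rw [← neg_sq ((A.card : ℝ) - _)]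
          exact pow_le_pow_left₀ hd.le (by linarith) 2
    _ ≤ S.card := by
        rw [sum_successWeight_mul_sq, sub_self]
        simpa using sum_mul_one_sub_le_card S hp

end PoissonBinomial

/-! ### Bounds on the number of rejections and on the rejected statistics. -/

section Ranking

variable {m : ℕ}

theorem mem_topSet {σ : Equiv.Perm (Fin m)} {k : ℕ} {i : Fin m} :
    i ∈ topSet σ k ↔ (σ.symm i : ℕ) < k := by
  simp [topSet]

theorem card_topSet (σ : Equiv.Perm (Fin m)) {k : ℕ} (hk : k ≤ m) : (topSet σ k).card = k := by
  have : topSet σ k = (Finset.univ.filter fun j : Fin m => (j : ℕ) < k).map σ.toEmbedding := by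
    ext i
    simp [mem_topSet]
  rw [this, Finset.card_map, Fin.card_filter_val_lt, min_eq_right hk]

theorem card_rejectionSet (γ α : ℝ) (t : Fin m → ℝ) (σ : Equiv.Perm (Fin m)) :
    (rejectionSet γ α t σ).card = numRejections γ α t σ :=
  card_topSet σ (Nat.findGreatest_le m)

/-- If `t i > c`, every index with statistic at most `c` comes strictly before `i`, so the position
of `i` is at least the number of such indices. -/
theorem IsRanking.le_of_mem_topSet {t : Fin m → ℝ} {σ : Equiv.Perm (Fin m)} (h : IsRanking t σ)
    {c : ℝ} {i : Fin m} (hi : i ∈ topSet σ (Finset.univ.filter fun j => t j ≤ c).card) :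
    t i ≤ c := by
  by_contra! hc
  refine (mem_topSet.1 hi).not_ge ?_
  have hsub : (Finset.univ.filter fun j => t j ≤ c) ⊆ topSet σ (σ.symm i : ℕ) := by
    intro j hj
    rw [mem_topSet]
    by_contra! hij
    have := h (show σ.symm i ≤ σ.symm j from hij)
    simp only [Function.comp_apply, Equiv.apply_symm_apply] at this
    linarith [(Finset.mem_filter.1 hj).2]
  simpa [card_topSet σ (σ.symm i).2.le] using Finset.card_le_card hsub

/-- The value `0` is excluded because it is also the default of `Nat.findGreatest`, and the sign of
`α` is not assumed here. -/
theorem poissonBinomialTail_rejectionSet_le {γ α : ℝ} {t : Fin m → ℝ}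
    {σ : Equiv.Perm (Fin m)} (hK : numRejections γ α t σ ≠ 0) :
    poissonBinomialTail (rejectionSet γ α t σ) t (γ * numRejections γ α t σ) ≤ α := by
  classical
  exact Nat.findGreatest_of_ne_zero (P := fun k : ℕ =>
    poissonBinomialTail (topSet σ k) t (γ * k) ≤ α) (m := numRejections γ α t σ) (n := m)
    (by rw [numRejections]) hK

theorem le_numRejections {γ α : ℝ} {t : Fin m → ℝ} {σ : Equiv.Perm (Fin m)} {k : ℕ} (hk : k ≤ m)
    (h : poissonBinomialTail (topSet σ k) t (γ * k) ≤ α) : k ≤ numRejections γ α t σ :=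
  Nat.le_findGreatest hk h

/-- Many statistics well below the level `γ` force many rejections. -/
theorem card_filter_le_numRejections {γ α c : ℝ} {t : Fin m → ℝ} {σ : Equiv.Perm (Fin m)}
    (ht : ∀ i, t i ∈ Set.Icc (0 : ℝ) 1) (hσ : IsRanking t σ) (hc : c < γ)
    (hk : 1 ≤ α * (γ - c) ^ 2 * (Finset.univ.filter fun j => t j ≤ c).card) :
    (Finset.univ.filter fun j => t j ≤ c).card ≤ numRejections γ α t σ := by
  set k := (Finset.univ.filter fun j => t j ≤ c).card with hkdef
  have hkm : k ≤ m := by simpa using Finset.card_filter_le Finset.univ fun j => t j ≤ c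
  have hk0 : (0 : ℝ) < k := by
    rcases (Nat.cast_nonneg (α := ℝ) k).eq_or_lt with h | h
    · rw [← h] at hk; norm_num at hk
    · exact h
  have hd : 0 < (γ - c) * k := mul_pos (sub_pos.2 hc) hk0
  refine le_numRejections hkm ((poissonBinomialTail_le ht hd ?_).trans ?_)
  · have : ∑ i ∈ topSet σ k, t i ≤ ∑ _i ∈ topSet σ k, c :=
      Finset.sum_le_sum fun i hi => hσ.le_of_mem_topSet hi
    rw [Finset.sum_const, card_topSet σ hkm, nsmul_eq_mul] at this
    linarith
  -- Chebyshev's bound is `k / ((γ - c) k)² = 1 / ((γ - c)² k)`, at most `α` by `hk`.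
  · rw [card_topSet σ hkm, div_le_iff₀ (by positivity)]
    nlinarith

/-- If there are many rejections, the average of the rejected statistics hardly exceeds `γ`. -/
theorem sum_rejectionSet_le {γ α d : ℝ} {t : Fin m → ℝ} {σ : Equiv.Perm (Fin m)}
    (ht : ∀ i, t i ∈ Set.Icc (0 : ℝ) 1) (hd : 0 < d)
    (hK : 1 < (1 - α) * d ^ 2 * numRejections γ α t σ) :
    ∑ i ∈ rejectionSet γ α t σ, t i ≤ (γ + d) * numRejections γ α t σ := by
  -- Otherwise the mean exceeds `γ K` by more than `d K`, and the tail is at least `1 - 1 / (d² K) >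
  -- α`.
  by_contra! h
  set k := numRejections γ α t σ with hkdef
  have hk0 : k ≠ 0 := by
    rintro h0
    rw [h0] at hK; norm_num at hK
  have hk : (0 : ℝ) < k := by positivity
  have h1 := one_sub_poissonBinomialTail_le ht (x := γ * k) (mul_pos hd hk)
    (by linarith : γ * k + d * k ≤ ∑ i ∈ rejectionSet γ α t σ, t i)
  have h2 := poissonBinomialTail_rejectionSet_le hk0
  rw [card_rejectionSet, ← hkdef, le_div_iff₀ (by positivity)] at h1
  rw [← hkdef] at h2
  have h3 : (1 - α) * (d * k) ^ 2 ≤ k :=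
    (mul_le_mul_of_nonneg_right (by linarith) (by positivity)).trans h1
  nlinarith

end Ranking

end FDX

/-! ### Deterministic control of the false discovery proportion. -/

namespace FDX

/-- The excess of the indicator of a true null hypothesis over its local false discovery rate. -/
noncomputable def nullExcess (π : ℝ) (f₀ f₁ : ℝ → ℝ) (x : Bool × ℝ) : ℝ :=
  (if x.1 = false then 1 else 0) - lfdr π f₀ f₁ x.2

/-- Well estimated indices cost at most `δ` each; the others cost at most `1` more and are counted
over all of `Fin m`, so that the count does not depend on `S`. -/
theorem sum_le_sum_add_of_abs_sub {m : ℕ} {t l : Fin m → ℝ} {δ : ℝ} (hδ : 0 ≤ δ)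
    (h : ∀ i, |t i - l i| ≤ 1) (S : Finset (Fin m)) :
    ∑ i ∈ S, l i ≤ ∑ i ∈ S, t i + δ * S.card +
      (Finset.univ.filter fun i => δ ≤ |t i - l i|).card := by
  have h1 : ∀ i ∈ S, l i ≤ t i + δ + if δ ≤ |t i - l i| then 1 else 0 := by
    intro i _
    have h2 := neg_abs_le (t i - l i)
    have h3 := h i
    split_ifs <;> linarith
  refine (Finset.sum_le_sum h1).trans ?_
  rw [Finset.sum_add_distrib, Finset.sum_add_distrib, Finset.sum_const, nsmul_eq_mul,
    Finset.sum_boole, mul_comm]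
  gcongr
  exact Finset.subset_univ S

/-- The false discovery proportion is controlled if many local false discovery rates are below
`γ`, most of them are well estimated, and the number of false rejections is close to the sum of
the local false discovery rates of the rejected hypotheses. -/
theorem fdp_rejectionSet_lt {m : ℕ} {γ α ε γ' δ p b : ℝ} {t l : Fin m → ℝ} {θ : Fin m → Bool}
    {σ : Equiv.Perm (Fin m)} (hα₀ : 0 < α) (hα₁ : α < 1) (hγ' : γ' < γ) (hε : 0 < ε)
    (hδ₀ : 0 < δ) (hδγ : δ ≤ (γ - γ') / 2) (hδε : δ ≤ ε / 4)
    (hbp : b ≤ p / 4) (hbε : b ≤ ε / 4 * (p / 4))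
    (ht : ∀ i, t i ∈ Set.Icc (0 : ℝ) 1) (hl : ∀ i, l i ∈ Set.Icc (0 : ℝ) 1)
    (hσ : IsRanking t σ)
    (hN : p / 2 * m ≤ (Finset.univ.filter fun i => l i < γ').card)
    (hB : (Finset.univ.filter fun i => δ ≤ |t i - l i|).card ≤ b * m)
    (hD : |∑ i ∈ rejectionSet γ α t σ, ((if θ i = false then 1 else 0) - l i)| < b * m)
    (hm₁ : 1 ≤ α * ((γ - γ') / 2) ^ 2 * (p / 4 * m))
    (hm₂ : 1 < (1 - α) * (ε / 4) ^ 2 * (p / 4 * m)) :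
    fdp θ (rejectionSet γ α t σ) < γ + ε := by
  have hm0 : (0 : ℝ) ≤ m := Nat.cast_nonneg m
  -- An error below `δ ≤ (γ - γ') / 2` cannot carry an estimate from below `γ'` past the midpoint of
  -- `γ'` and `γ`.
  have hsub : (Finset.univ.filter fun i => l i < γ') ⊆
      (Finset.univ.filter fun i => t i ≤ (γ + γ') / 2) ∪
        Finset.univ.filter fun i => δ ≤ |t i - l i| := by
    intro i hi
    simp only [Finset.mem_union, Finset.mem_filter, Finset.mem_univ, true_and] at hi ⊢
    by_contra! h
    have h1 := le_abs_self (t i - l i)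
    linarith [h.1, h.2]
  have hcard : ((Finset.univ.filter fun i => l i < γ').card : ℝ) ≤
      (Finset.univ.filter fun i => t i ≤ (γ + γ') / 2).card +
        (Finset.univ.filter fun i => δ ≤ |t i - l i|).card := by
    exact_mod_cast (Finset.card_le_card hsub).trans (Finset.card_union_le _ _)
  have hbm : b * m ≤ p / 4 * m := mul_le_mul_of_nonneg_right hbp hm0
  have hk : p / 4 * m ≤ (Finset.univ.filter fun i => t i ≤ (γ + γ') / 2).card := by linarith
  have hγγ : γ - (γ + γ') / 2 = (γ - γ') / 2 := by ring
  have hkK := card_filter_le_numRejections (γ := γ) (α := α) (c := (γ + γ') / 2) ht hσ (by linarith) <| by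
    rw [hγγ]
    exact hm₁.trans (mul_le_mul_of_nonneg_left hk (by positivity))
  set K := numRejections γ α t σ with hKdef
  have hK : p / 4 * m ≤ K := hk.trans (by exact_mod_cast hkK)
  have hK1 : 1 < (1 - α) * (ε / 4) ^ 2 * K :=
    hm₂.trans_le (mul_le_mul_of_nonneg_left hK
      (mul_nonneg (sub_nonneg.2 hα₁.le) (by positivity)))
  have hsum := sum_rejectionSet_le (γ := γ) ht (by positivity : 0 < ε / 4) hK1
  have hKpos : 0 < K := by
    rcases Nat.eq_zero_or_pos K with h | h
    · rw [h] at hK1; norm_num at hK1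
    · exact h
  have hKR : (0 : ℝ) < K := by exact_mod_cast hKpos
  have hl' := sum_le_sum_add_of_abs_sub (t := t) (l := l) hδ₀.le
    (fun i => abs_le.2 ⟨by linarith [(ht i).1, (hl i).2], by linarith [(ht i).2, (hl i).1]⟩)
    (rejectionSet γ α t σ)
  rw [card_rejectionSet, ← hKdef] at hl'
  -- The lower bound `K ≥ (p / 4) m` turns errors of order `m` into errors relative to `K`.
  have hbK : b * m ≤ ε / 4 * K :=
    calc b * m ≤ ε / 4 * (p / 4) * m := mul_le_mul_of_nonneg_right hbε hm0
      _ = ε / 4 * (p / 4 * m) := by ring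
      _ ≤ ε / 4 * K := mul_le_mul_of_nonneg_left hK (by positivity)
  have hD' := (le_abs_self _).trans_lt hD
  rw [Finset.sum_sub_distrib, Finset.sum_boole] at hD'
  have hδK : δ * K ≤ ε / 4 * K := mul_le_mul_of_nonneg_right hδε hKR.le
  rw [fdp, card_rejectionSet, ← hKdef, max_eq_left (by exact_mod_cast hKpos), div_lt_iff₀ hKR]
  -- Four shares of `ε / 4`: the Poisson binomial slack, the error `δ`, the badly estimated indices,
  -- and the fluctuation of the null count.
  linarith

/-! ### Chebyshev and Markov bounds for sums. -/

section SecondMoment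

variable {Ω : Type*} [MeasurableSpace Ω] {P : Measure Ω} [IsProbabilityMeasure P] {m : ℕ}

/-- Orthogonality kills the cross terms, leaving a second moment of at most `m`. Independence would
be too much to ask: the summands for the rejected set all depend on the whole data. -/
theorem measureReal_le_abs_sum_le {W : Fin m → Ω → ℝ} (hW : ∀ i, Measurable (W i))
    (hb : ∀ i ω, |W i ω| ≤ 1) (horth : ∀ i j, i ≠ j → ∫ ω, W i ω * W j ω ∂P = 0)
    {a : ℝ} (ha : 0 < a) :
    P.real {ω | a ≤ |∑ i, W i ω|} ≤ m / a ^ 2 := by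
  have hint : ∀ i j, Integrable (fun ω => W i ω * W j ω) P := fun i j =>
    Integrable.of_bound ((hW i).mul (hW j)).aestronglyMeasurable 1 <| ae_of_all _ fun ω => by
      rw [Real.norm_eq_abs, abs_mul]
      exact mul_le_one₀ (hb i ω) (abs_nonneg _) (hb j ω)
  have hsq : ∀ ω, (∑ i, W i ω) ^ 2 = ∑ i, ∑ j, W i ω * W j ω := fun ω => by
    rw [sq, Finset.sum_mul_sum]
  have hI : ∫ ω, (∑ i, W i ω) ^ 2 ∂P ≤ m := by
    simp_rw [hsq]
    rw [integral_finsetSum _ fun i _ => integrable_finsetSum _ fun j _ => hint i j]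
    calc _ ≤ ∑ _i : Fin m, (1 : ℝ) := by
          refine Finset.sum_le_sum fun i _ => ?_
          rw [integral_finsetSum _ fun j _ => hint i j,
            Finset.sum_eq_single i (fun j _ hj => horth i j hj.symm) (by simp)]
          refine (integral_mono (hint i i) (integrable_const 1) fun ω => ?_).trans_eq (by simp)
          have := sq_le_one_iff_abs_le_one (W i ω) |>.2 (hb i ω)
          nlinarith
      _ = m := by simp
  have hM := mul_meas_ge_le_integral_of_nonneg (μ := P) (f := fun ω => (∑ i, W i ω) ^ 2)
    (ae_of_all _ fun ω => sq_nonneg _)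
    (by simp_rw [hsq]; exact integrable_finsetSum _ fun i _ => integrable_finsetSum _ fun j _ => hint i j)
    (a ^ 2)
  rw [le_div_iff₀ (by positivity), mul_comm]
  refine le_trans ?_ (hM.trans hI)
  refine mul_le_mul_of_nonneg_left (measureReal_mono fun ω hω => ?_) (by positivity)
  change a ^ 2 ≤ (∑ i, W i ω) ^ 2
  rw [← sq_abs (∑ i, W i ω)]
  exact pow_le_pow_left₀ ha.le hω 2

/-- Markov's inequality for the count, whose expectation is at most `m s`; the events may be
dependent, as those of estimation errors are. -/
theorem measureReal_lt_card_filter_le {q : Fin m → Ω → Prop} [∀ i ω, Decidable (q i ω)]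
    (hq : ∀ i, MeasurableSet {ω | q i ω}) {s b : ℝ} (hb : 0 < b)
    (hs : ∀ i, P.real {ω | q i ω} ≤ s) (hs0 : 0 ≤ s) :
    P.real {ω | b * m < (Finset.univ.filter fun i => q i ω).card} ≤ s / b := by
  rcases Nat.eq_zero_or_pos m with rfl | hm
  · simp only [Finset.univ_eq_empty, Finset.filter_empty]
    simpa using div_nonneg hs0 hb.le
  have hm' : (0 : ℝ) < m := by exact_mod_cast hm
  have hcard : ∀ ω, ((Finset.univ.filter fun i => q i ω).card : ℝ) =
      ∑ i, {ω | q i ω}.indicator (fun _ => (1 : ℝ)) ω := fun ω => by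
    rw [Finset.card_filter]
    push_cast
    exact Finset.sum_congr rfl fun i _ => by simp only [Set.indicator_apply, Set.mem_ofPred_eq]
  have hint : ∀ i, Integrable ({ω | q i ω}.indicator fun _ => (1 : ℝ)) P := fun i =>
    (integrable_const 1).indicator (hq i)
  have hM := mul_meas_ge_le_integral_of_nonneg (μ := P)
    (f := fun ω => ∑ i, {ω | q i ω}.indicator (fun _ => (1 : ℝ)) ω)
    (ae_of_all _ fun ω => Finset.sum_nonneg fun i _ =>
      Set.indicator_nonneg (fun _ _ => zero_le_one) ω)
    (integrable_finsetSum _ fun i _ => hint i) (b * m)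
  rw [integral_finsetSum _ fun i _ => hint i] at hM
  have hS : ∑ i, ∫ ω, {ω | q i ω}.indicator (fun _ => (1 : ℝ)) ω ∂P ≤ m * s := by
    have : ∀ i ∈ Finset.univ, ∫ ω, {ω | q i ω}.indicator (fun _ => (1 : ℝ)) ω ∂P ≤ s := fun i _ => by
      rw [integral_indicator_const _ (hq i)]
      simpa using hs i
    simpa using Finset.sum_le_sum this
  rw [le_div_iff₀ hb]
  refine le_of_mul_le_mul_left (le_trans ?_ (hM.trans hS)) hm'
  have : P.real {ω | b * m < ((Finset.univ.filter fun i => q i ω).card : ℝ)} ≤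
      P.real {ω | b * m ≤ ∑ i, {ω | q i ω}.indicator (fun _ => (1 : ℝ)) ω} := by
    refine measureReal_mono fun ω hω => ?_
    simp only [Set.mem_ofPred_eq] at hω ⊢
    rw [← hcard]
    exact hω.le
  nlinarith [mul_le_mul_of_nonneg_left this (mul_pos hb hm').le]

end SecondMoment

end FDX

/-! ### The two-group law and the local false discovery rate. -/

namespace FDX

theorem IsDensity.isProbabilityMeasure {f : ℝ → ℝ} (hf : IsDensity f) :
    IsProbabilityMeasure (densityLaw f) :=
  ⟨by rw [densityLaw, withDensity_apply _ MeasurableSet.univ, Measure.restrict_univ,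
    hf.lintegral_eq_one]⟩

theorem IsDensity.integrable {f : ℝ → ℝ} (hf : IsDensity f) : Integrable f :=
  (lintegral_ofReal_ne_top_iff_integrable hf.measurable.aestronglyMeasurable
    (ae_of_all _ hf.nonneg)).1 (by rw [hf.lintegral_eq_one]; exact ENNReal.one_ne_top)

section TwoGroup

variable {π : ℝ} {f₀ f₁ : ℝ → ℝ}

theorem measurable_mixtureDensity (hf₀ : IsDensity f₀) (hf₁ : IsDensity f₁) :
    Measurable (mixtureDensity π f₀ f₁) :=
  (hf₀.measurable.const_mul _).add (hf₁.measurable.const_mul _)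

theorem measurable_lfdr (hf₀ : IsDensity f₀) (hf₁ : IsDensity f₁) :
    Measurable (lfdr π f₀ f₁) :=
  (hf₀.measurable.const_mul _).div (measurable_mixtureDensity hf₀ hf₁)

theorem lfdr_mem_Icc (hπ₀ : 0 ≤ π) (hπ₁ : π ≤ 1) (hf₀ : IsDensity f₀) (hf₁ : IsDensity f₁)
    (z : ℝ) : lfdr π f₀ f₁ z ∈ Set.Icc (0 : ℝ) 1 := by
  have h0 : 0 ≤ (1 - π) * f₀ z := mul_nonneg (sub_nonneg.2 hπ₁) (hf₀.nonneg z)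
  have h1 : 0 ≤ π * f₁ z := mul_nonneg hπ₀ (hf₁.nonneg z)
  exact ⟨div_nonneg h0 (add_nonneg h0 h1), div_le_one_of_le₀ (by rw [mixtureDensity]; linarith)
    (add_nonneg h0 h1)⟩

/-- Where the mixture density vanishes, so does the numerator, so the convention for division by
zero does no harm. -/
theorem lfdr_mul_mixtureDensity (hπ₀ : 0 ≤ π) (hπ₁ : π ≤ 1) (hf₀ : IsDensity f₀)
    (hf₁ : IsDensity f₁) (z : ℝ) :
    lfdr π f₀ f₁ z * mixtureDensity π f₀ f₁ z = (1 - π) * f₀ z := by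
  have h0 : 0 ≤ (1 - π) * f₀ z := mul_nonneg (sub_nonneg.2 hπ₁) (hf₀.nonneg z)
  have h1 : 0 ≤ π * f₁ z := mul_nonneg hπ₀ (hf₁.nonneg z)
  refine div_mul_cancel_of_imp fun h => ?_
  rw [mixtureDensity] at h
  linarith

theorem measurable_nullExcess (hf₀ : IsDensity f₀) (hf₁ : IsDensity f₁) :
    Measurable (nullExcess π f₀ f₁) :=
  (Measurable.ite (measurable_fst (measurableSet_singleton false)) measurable_const
    measurable_const).sub ((measurable_lfdr hf₀ hf₁).comp measurable_snd)

theorem abs_nullExcess_le (hπ₀ : 0 ≤ π) (hπ₁ : π ≤ 1) (hf₀ : IsDensity f₀) (hf₁ : IsDensity f₁)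
    (x : Bool × ℝ) : |nullExcess π f₀ f₁ x| ≤ 1 := by
  have h := lfdr_mem_Icc hπ₀ hπ₁ hf₀ hf₁ x.2
  rw [nullExcess, abs_le]
  split_ifs <;> constructor <;> linarith [h.1, h.2]

theorem integral_densityLaw {f : ℝ → ℝ} (hf : IsDensity f) (g : ℝ → ℝ) :
    ∫ z, g z ∂densityLaw f = ∫ z, f z * g z := by
  rw [densityLaw, integral_withDensity_eq_integral_toReal_smul hf.measurable.ennreal_ofReal
    (ae_of_all _ fun z => ENNReal.ofReal_lt_top)]
  exact integral_congr_ae (ae_of_all _ fun z => by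
    simp [ENNReal.toReal_ofReal (hf.nonneg z)])

/-- The local false discovery rate is the conditional probability of the null hypothesis given
the observation. -/
theorem integral_nullExcess_mul (hπ₀ : 0 ≤ π) (hπ₁ : π ≤ 1) (hf₀ : IsDensity f₀)
    (hf₁ : IsDensity f₁) {h : ℝ → ℝ} (hh : Measurable h) {C : ℝ} (hC : ∀ z, |h z| ≤ C) :
    ∫ x, nullExcess π f₀ f₁ x * h x.2 ∂twoGroupLaw π f₀ f₁ = 0 := by
  have := hf₀.isProbabilityMeasure
  have := hf₁.isProbabilityMeasure
  have hmeas : Measurable fun x : Bool × ℝ => nullExcess π f₀ f₁ x * h x.2 :=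
    (measurable_nullExcess hf₀ hf₁).mul (hh.comp measurable_snd)
  have hbound : ∀ x : Bool × ℝ, ‖nullExcess π f₀ f₁ x * h x.2‖ ≤ C := fun x => by
    rw [Real.norm_eq_abs, abs_mul]
    exact (mul_le_of_le_one_left (abs_nonneg _) (abs_nullExcess_le hπ₀ hπ₁ hf₀ hf₁ x)).trans
      (hC x.2)
  have hint : ∀ (b : Bool) (f : ℝ → ℝ), IsProbabilityMeasure (densityLaw f) →
      Integrable (fun x : Bool × ℝ => nullExcess π f₀ f₁ x * h x.2)
        ((Measure.dirac b).prod (densityLaw f)) := fun b f _ =>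
    Integrable.of_bound hmeas.aestronglyMeasurable C (ae_of_all _ hbound)
  have hvol : ∀ (b : Bool) (f : ℝ → ℝ), IsDensity f →
      Integrable (fun z => f z * (nullExcess π f₀ f₁ (b, z) * h z)) := fun b f hf =>
    hf.integrable.mul_bdd (hmeas.comp measurable_prodMk_left).aestronglyMeasurable
      (ae_of_all _ fun z => hbound (b, z))
  rw [twoGroupLaw, integral_add_measure ((hint _ _ inferInstance).smul_measure ENNReal.ofReal_ne_top)
    ((hint _ _ inferInstance).smul_measure ENNReal.ofReal_ne_top), integral_smul_measure,
    integral_smul_measure, Measure.dirac_prod, Measure.dirac_prod,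
    integral_map measurable_prodMk_left.aemeasurable hmeas.aestronglyMeasurable,
    integral_map measurable_prodMk_left.aemeasurable hmeas.aestronglyMeasurable,
    integral_densityLaw hf₀, integral_densityLaw hf₁, ENNReal.toReal_ofReal (sub_nonneg.2 hπ₁),
    ENNReal.toReal_ofReal hπ₀, smul_eq_mul, smul_eq_mul, ← integral_const_mul,
    ← integral_const_mul, ← integral_add ((hvol _ _ hf₀).const_mul _) ((hvol _ _ hf₁).const_mul _)]
  -- The integrand is `h` times `(1 - π) f₀ (1 - lfdr) - π f₁ lfdr = (1 - π) f₀ - lfdr f`, which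
  -- vanishes pointwise.
  refine integral_eq_zero_of_ae (ae_of_all _ fun z => ?_)
  have hz := lfdr_mul_mixtureDensity hπ₀ hπ₁ hf₀ hf₁ z
  rw [mixtureDensity] at hz
  simp only [nullExcess, Pi.zero_apply, if_true, Bool.true_eq_false, if_false]
  linear_combination (-h z) * hz

theorem map_snd_twoGroupLaw (hπ₀ : 0 ≤ π) (hπ₁ : π ≤ 1) (hf₀ : IsDensity f₀)
    (hf₁ : IsDensity f₁) :
    (twoGroupLaw π f₀ f₁).map Prod.snd = densityLaw (mixtureDensity π f₀ f₁) := by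
  have := hf₀.isProbabilityMeasure
  have := hf₁.isProbabilityMeasure
  have hmix : (fun z => ENNReal.ofReal (mixtureDensity π f₀ f₁ z)) =
      (ENNReal.ofReal (1 - π) • fun z => ENNReal.ofReal (f₀ z)) +
        ENNReal.ofReal π • fun z => ENNReal.ofReal (f₁ z) := by
    funext z
    simp only [Pi.add_apply, Pi.smul_apply, smul_eq_mul]
    rw [← ENNReal.ofReal_mul (sub_nonneg.2 hπ₁), ← ENNReal.ofReal_mul hπ₀, ← ENNReal.ofReal_add
      (mul_nonneg (sub_nonneg.2 hπ₁) (hf₀.nonneg z)) (mul_nonneg hπ₀ (hf₁.nonneg z))]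
    rfl
  rw [twoGroupLaw, Measure.map_add _ _ measurable_snd, Measure.map_smul, Measure.map_smul,
    Measure.map_snd_prod, Measure.map_snd_prod, measure_univ, one_smul, measure_univ, one_smul,
    densityLaw, densityLaw, densityLaw, hmix,
    withDensity_add_left (hf₀.measurable.ennreal_ofReal.const_smul _),
    withDensity_smul _ hf₀.measurable.ennreal_ofReal,
    withDensity_smul _ hf₁.measurable.ennreal_ofReal]

theorem IsTwoGroupSample.map_Z {Ω : Type*} [MeasurableSpace Ω] {P : Measure Ω} {m : ℕ}
    {θ : Fin m → Ω → Bool} {Z : Fin m → Ω → ℝ} (hs : IsTwoGroupSample P π f₀ f₁ θ Z)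
    (hπ₀ : 0 ≤ π) (hπ₁ : π ≤ 1) (hf₀ : IsDensity f₀) (hf₁ : IsDensity f₁) (i : Fin m) :
    P.map (Z i) = densityLaw (mixtureDensity π f₀ f₁) := by
  rw [← map_snd_twoGroupLaw hπ₀ hπ₁ hf₀ hf₁, ← hs.law i,
    Measure.map_map measurable_snd ((hs.measurable_theta i).prodMk (hs.measurable_Z i))]
  rfl

end TwoGroup

/-! ### Orthogonality and concentration in the sample. -/

section Sample

variable {Ω : Type*} [MeasurableSpace Ω] {P : Measure Ω} [IsProbabilityMeasure P] {m : ℕ}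
  {π : ℝ} {f₀ f₁ : ℝ → ℝ} {θ : Fin m → Ω → Bool} {Z : Fin m → Ω → ℝ}

/-- The excess of the `i`-th null indicator is orthogonal to the bounded functions of the `i`-th
observation and of all the other pairs. -/
theorem IsTwoGroupSample.integral_nullExcess_mul_eq_zero (hs : IsTwoGroupSample P π f₀ f₁ θ Z)
    (hπ₀ : 0 ≤ π) (hπ₁ : π ≤ 1) (hf₀ : IsDensity f₀) (hf₁ : IsDensity f₁) (i : Fin m)
    {H : ℝ × (({i}ᶜ : Finset (Fin m)) → Bool × ℝ) → ℝ} (hH : Measurable H) {C : ℝ}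
    (hC : ∀ x, |H x| ≤ C) :
    ∫ ω, nullExcess π f₀ f₁ (θ i ω, Z i ω) * H (Z i ω, fun j => (θ j ω, Z j ω)) ∂P = 0 := by
  have hX : ∀ j, Measurable fun ω => (θ j ω, Z j ω) := fun j =>
    (hs.measurable_theta j).prodMk (hs.measurable_Z j)
  have hY : Measurable fun ω (j : ({i}ᶜ : Finset (Fin m))) => (θ j ω, Z j ω) :=
    measurable_pi_lambda _ fun j => hX j
  have hind : IndepFun (fun ω => (θ i ω, Z i ω))
      (fun ω (j : ({i}ᶜ : Finset (Fin m))) => (θ j ω, Z j ω)) P :=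
    (hs.indep.indepFun_finset {i} {i}ᶜ disjoint_compl_right hX).comp
      (φ := fun x : ({i} : Finset (Fin m)) → Bool × ℝ => x ⟨i, Finset.mem_singleton_self i⟩)
      (measurable_pi_apply _) measurable_id
  have hmap := hind.map_prod_eq_prod_map_map (hX i).aemeasurable hY.aemeasurable
  rw [hs.law i] at hmap
  have hprob : IsProbabilityMeasure (twoGroupLaw π f₀ f₁) := by
    rw [← hs.law i]
    exact Measure.isProbabilityMeasure_map (hX i).aemeasurable
  have hprob' := Measure.isProbabilityMeasure_map (μ := P) hY.aemeasurable
  have hG : Measurable fun x : (Bool × ℝ) × (({i}ᶜ : Finset (Fin m)) → Bool × ℝ) =>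
      nullExcess π f₀ f₁ x.1 * H (x.1.2, x.2) :=
    ((measurable_nullExcess hf₀ hf₁).comp measurable_fst).mul (hH.comp (by fun_prop))
  have hint : Integrable (fun x : (Bool × ℝ) × (({i}ᶜ : Finset (Fin m)) → Bool × ℝ) =>
      nullExcess π f₀ f₁ x.1 * H (x.1.2, x.2)) ((twoGroupLaw π f₀ f₁).prod
        (P.map fun ω (j : ({i}ᶜ : Finset (Fin m))) => (θ j ω, Z j ω))) :=
    Integrable.of_bound hG.aestronglyMeasurable C <| ae_of_all _ fun x => by
      rw [Real.norm_eq_abs, abs_mul]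
      exact (mul_le_of_le_one_left (abs_nonneg _) (abs_nullExcess_le hπ₀ hπ₁ hf₀ hf₁ _)).trans
        (hC _)
  -- Fubini with the `i`-th pair integrated first: for the other pairs frozen at `y`, `H (·, y)` is
  -- a bounded function of the observation alone.
  have h1 := integral_map (μ := P) ((hX i).prodMk hY).aemeasurable hG.aestronglyMeasurable
  rw [hmap, integral_prod_symm _ hint] at h1
  rw [← h1]
  refine integral_eq_zero_of_ae (ae_of_all _ fun y => ?_)
  exact integral_nullExcess_mul hπ₀ hπ₁ hf₀ hf₁ (h := fun z => H (z, y))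
    (hH.comp measurable_prodMk_right) fun z => hC _

/-- The number of true null hypotheses in a data-dependent set of hypotheses is close to the sum
of their local false discovery rates. -/
theorem IsTwoGroupSample.measureReal_le_abs_sum_nullExcess (hs : IsTwoGroupSample P π f₀ f₁ θ Z)
    (hπ₀ : 0 ≤ π) (hπ₁ : π ≤ 1) (hf₀ : IsDensity f₀) (hf₁ : IsDensity f₁)
    {S : (Fin m → ℝ) → Finset (Fin m)} (hS : ∀ i, MeasurableSet {z | i ∈ S z}) {a : ℝ}
    (ha : 0 < a) :
    P.real {ω | a ≤ |∑ i ∈ S fun j => Z j ω, nullExcess π f₀ f₁ (θ i ω, Z i ω)|} ≤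
      m / a ^ 2 := by
  have hX : ∀ j, Measurable fun ω => (θ j ω, Z j ω) := fun j =>
    (hs.measurable_theta j).prodMk (hs.measurable_Z j)
  set A : Fin m → (Fin m → ℝ) → ℝ := fun i z => if i ∈ S z then 1 else 0 with hA
  have hAmeas : ∀ i, Measurable (A i) := fun i =>
    Measurable.ite (hS i) measurable_const measurable_const
  have hAb : ∀ i z, |A i z| ≤ 1 := fun i z => by
    simp only [hA]; split_ifs <;> simp
  have hZ : Measurable fun ω j => Z j ω := measurable_pi_lambda _ hs.measurable_Z
  have hsum : ∀ ω, ∑ i ∈ S fun j => Z j ω, nullExcess π f₀ f₁ (θ i ω, Z i ω) =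
      ∑ i, nullExcess π f₀ f₁ (θ i ω, Z i ω) * A i fun j => Z j ω := fun ω => by
    simp [hA]
  simp_rw [hsum]
  refine measureReal_le_abs_sum_le (W := fun i ω =>
      nullExcess π f₀ f₁ (θ i ω, Z i ω) * A i fun j => Z j ω)
    (fun i => ((measurable_nullExcess hf₀ hf₁).comp (hX i)).mul ((hAmeas i).comp hZ))
    (fun i ω => ?_) (fun i j hij => ?_) ha
  · rw [abs_mul]
    exact mul_le_one₀ (abs_nullExcess_le hπ₀ hπ₁ hf₀ hf₁ _) (abs_nonneg _) (hAb _ _)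
  · have hj : j ∈ ({i}ᶜ : Finset (Fin m)) := by simpa using hij.symm
    -- Rebuilds the data vector from `Z i` and the other pairs. Both selection indicators and, as `j
    -- ≠ i`, the `j`-th excess thus become functions of these, without `θ i`.
    let rec' : ℝ × (({i}ᶜ : Finset (Fin m)) → Bool × ℝ) → Fin m → ℝ := fun x k =>
      if hk : k ∈ ({i}ᶜ : Finset (Fin m)) then (x.2 ⟨k, hk⟩).2 else x.1
    have hrec : Measurable rec' := by
      refine measurable_pi_lambda _ fun k => ?_
      by_cases hk : k ∈ ({i}ᶜ : Finset (Fin m))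
      · simp only [rec', dif_pos hk]; fun_prop
      · simp only [rec', dif_neg hk]; fun_prop
    have hrecZ : ∀ ω, rec' (Z i ω, fun k => (θ k ω, Z k ω)) = fun k => Z k ω := fun ω => by
      funext k
      by_cases hk : k ∈ ({i}ᶜ : Finset (Fin m))
      · simp only [rec', dif_pos hk]
      · simp only [rec', dif_neg hk]
        have : k = i := by simpa using hk
        rw [this]
    have h := hs.integral_nullExcess_mul_eq_zero hπ₀ hπ₁ hf₀ hf₁ i (C := 1)
      (H := fun x => A i (rec' x) * (nullExcess π f₀ f₁ (x.2 ⟨j, hj⟩) * A j (rec' x)))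
      (((hAmeas i).comp hrec).mul (((measurable_nullExcess hf₀ hf₁).comp (by fun_prop)).mul
        ((hAmeas j).comp hrec)))
      (fun x => by
        rw [abs_mul, abs_mul]
        exact mul_le_one₀ (hAb _ _) (by positivity)
          (mul_le_one₀ (abs_nullExcess_le hπ₀ hπ₁ hf₀ hf₁ _) (abs_nonneg _) (hAb _ _)))
    simp only [hrecZ] at h
    rw [← h]
    exact integral_congr_ae (ae_of_all _ fun ω => by ring)

/-- The number of observations in a set is close to its expectation. -/
theorem IsTwoGroupSample.measureReal_card_filter_lt (hs : IsTwoGroupSample P π f₀ f₁ θ Z)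
    (hπ₀ : 0 ≤ π) (hπ₁ : π ≤ 1) (hf₀ : IsDensity f₀) (hf₁ : IsDensity f₁)
    {q : ℝ → Prop} [DecidablePred q] (hq : MeasurableSet {z | q z}) (hm : 0 < m) {p : ℝ}
    (hp₀ : 0 < p) (hp : (densityLaw (mixtureDensity π f₀ f₁)).real {z | q z} = p) :
    P.real {ω | ((Finset.univ.filter fun i => q (Z i ω)).card : ℝ) < p / 2 * m} ≤
      m / (p / 2 * m) ^ 2 := by
  have hm' : (0 : ℝ) < m := by exact_mod_cast hm
  have hPE : ∀ i, P.real (Z i ⁻¹' {z | q z}) = p := fun i => by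
    rw [← hp, ← hs.map_Z hπ₀ hπ₁ hf₀ hf₁ i, map_measureReal_apply (hs.measurable_Z i) hq]
  have hp₁ : p ≤ 1 := by
    rw [← hPE ⟨0, hm⟩]; exact measureReal_le_one
  set g : ℝ → ℝ := fun z => {z | q z}.indicator (fun _ => 1) z - p with hg
  have hgm : Measurable g := (measurable_const.indicator hq).sub measurable_const
  have hgb : ∀ z, |g z| ≤ 1 := fun z => by
    simp only [hg, Set.indicator_apply]
    rw [abs_le]
    split_ifs <;> constructor <;> linarith
  have hg0 : ∀ i, ∫ ω, g (Z i ω) ∂P = 0 := fun i => by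
    have hq' := hs.measurable_Z i hq
    have h1 : (fun ω => {z | q z}.indicator (fun _ => (1 : ℝ)) (Z i ω)) =
      (Z i ⁻¹' {z | q z}).indicator fun _ => (1 : ℝ) := rfl
    simp only [hg]
    rw [integral_sub (by rw [h1]; exact (integrable_const _).indicator hq') (integrable_const _),
      h1, integral_indicator_const _ hq', hPE]
    simp
  refine le_trans (measureReal_mono fun ω hω => ?_)
    (measureReal_le_abs_sum_le (P := P) (W := fun i ω => g (Z i ω))
      (fun i => hgm.comp (hs.measurable_Z i)) (fun i ω => hgb _) (fun i j hij => ?_)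
      (by positivity : 0 < p / 2 * m))
  · have h1 : ∑ i, g (Z i ω) = ((Finset.univ.filter fun i => q (Z i ω)).card : ℝ) - m * p := by
      simp only [hg, Finset.sum_sub_distrib, Set.indicator_apply, Set.mem_ofPred_eq,
        Finset.sum_boole]
      simp
    have h2 : ((Finset.univ.filter fun i => q (Z i ω)).card : ℝ) < p / 2 * m := hω
    change _ ≤ |∑ i, g (Z i ω)|
    rw [h1]
    -- A count below half its mean `m p` deviates from it by more than `p / 2 * m`.
    exact le_trans (by linarith) (neg_le_abs _)
  · have hind : IndepFun (fun ω => g (Z i ω)) (fun ω => g (Z j ω)) P :=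
      (hs.indep.indepFun hij).comp (φ := fun x : Bool × ℝ => g x.2)
        (ψ := fun x : Bool × ℝ => g x.2) (hgm.comp measurable_snd) (hgm.comp measurable_snd)
    rw [hind.integral_fun_mul_eq_mul_integral
      (hgm.comp (hs.measurable_Z i)).aestronglyMeasurable
      (hgm.comp (hs.measurable_Z j)).aestronglyMeasurable, hg0, zero_mul]

end Sample

end FDX

/-! ### Measurability of the procedure and auxiliary limits. -/

namespace FDX

section Measurability

variable {X : Type*} [MeasurableSpace X] {m : ℕ}

theorem measurable_poissonBinomialTail (S : Finset (Fin m)) (x : ℝ) :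
    Measurable fun t : Fin m → ℝ => poissonBinomialTail S t x := by
  unfold poissonBinomialTail poissonBinomialMass
  fun_prop

/-- Only finitely many rankings exist, so the event splits according to the value of `R`. -/
theorem measurableSet_mem_rejectionSet (γ α : ℝ) {T : X → Fin m → ℝ} (hT : Measurable T)
    {R : X → Equiv.Perm (Fin m)} (hR : ∀ σ, MeasurableSet {z | R z = σ}) (i : Fin m) :
    MeasurableSet {z | i ∈ rejectionSet γ α (T z) (R z)} := by
  classical
  have h1 : ∀ σ, MeasurableSet {z | i ∈ rejectionSet γ α (T z) σ} := fun σ => by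
    have : Measurable fun z => numRejections γ α (T z) σ := by
      unfold numRejections
      exact measurable_findGreatest fun k _ =>
        measurableSet_le ((measurable_poissonBinomialTail _ _).comp hT) measurable_const
    simp only [rejectionSet, mem_topSet]
    exact measurableSet_lt measurable_const this
  have h2 : {z | i ∈ rejectionSet γ α (T z) (R z)} =
      ⋃ σ, {z | R z = σ} ∩ {z | i ∈ rejectionSet γ α (T z) σ} := by
    ext z; simp
  rw [h2]
  exact MeasurableSet.iUnion fun σ => (hR σ).inter (h1 σ)

end Measurability

theorem tendsto_natCast_div_mul_sq {c : ℝ} (hc : 0 < c) :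
    Tendsto (fun m : ℕ => (m : ℝ) / (c * m) ^ 2) atTop (𝓝 0) := by
  have h : Tendsto (fun m : ℕ => (c ^ 2)⁻¹ * (m : ℝ)⁻¹) atTop (𝓝 ((c ^ 2)⁻¹ * 0)) :=
    tendsto_inv_atTop_nhds_zero_nat.const_mul _
  rw [mul_zero] at h
  refine h.congr fun m => ?_
  rcases Nat.eq_zero_or_pos m with rfl | hm
  · simp
  · have : (m : ℝ) ≠ 0 := by positivity
    field_simp

/-- Exhaustion by countably many sublevel sets. It provides the gap below `γ` that absorbs
estimation errors. -/
theorem exists_lt_measure_lt_pos {X : Type*} [MeasurableSpace X] {μ : Measure X} {g : X → ℝ}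
    {c : ℝ} (h : 0 < μ {x | g x < c}) : ∃ c' < c, 0 < μ {x | g x < c'} := by
  by_contra! hc
  have hu : {x | g x < c} ⊆ ⋃ n : ℕ, {x | g x < c - 1 / ((n : ℝ) + 1)} := fun x hx => by
    obtain ⟨n, hn⟩ := exists_nat_one_div_lt (sub_pos.2 (show g x < c from hx))
    exact Set.mem_iUnion.2 ⟨n, show g x < c - 1 / ((n : ℝ) + 1) by linarith⟩
  refine h.not_ge ((measure_mono hu).trans (measure_iUnion_null fun n => ?_).le)
  exact nonpos_iff_eq_zero.1 (hc _ (sub_lt_self c (by positivity)))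

end FDX

/-! ### Assembly of the asymptotic bound. -/

theorem proposition4
    (γ α : ℝ) (hγ₀ : 0 < γ) (hγ₁ : γ < 1) (hα₀ : 0 < α) (hα₁ : α < 1)
    (π : ℝ) (hπ₀ : 0 ≤ π) (hπ₁ : π ≤ 1)
    (f₀ f₁ : ℝ → ℝ) (hf₀ : FDX.IsDensity f₀) (hf₁ : FDX.IsDensity f₁)
    -- the local false discovery rate is below `γ` with positive probability
    (hpos : 0 < FDX.densityLaw (FDX.mixtureDensity π f₀ f₁) {z | FDX.lfdr π f₀ f₁ z < γ})
    -- for each `m`, a sample of size `m` from the two-group model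
    {Ω : ℕ → Type*} [∀ m, MeasurableSpace (Ω m)]
    (P : ∀ m, Measure (Ω m)) [∀ m, IsProbabilityMeasure (P m)]
    (θ : ∀ m, Fin m → Ω m → Bool) (Z : ∀ m, Fin m → Ω m → ℝ)
    (hmodel : ∀ m, FDX.IsTwoGroupSample (P m) π f₀ f₁ (θ m) (Z m))
    -- the estimates, functions of the observed data with values in `[0, 1]`
    (T : ∀ m, (Fin m → ℝ) → Fin m → ℝ) (hT_meas : ∀ m, Measurable (T m))
    (hT_mem : ∀ m z i, T m z i ∈ Set.Icc (0 : ℝ) 1)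
    (hT_cons : FDX.IsConsistentLfdr P π f₀ f₁ Z T)
    -- a ranking of the estimates, with any rule for ties that depends measurably on the data
    (R : ∀ m, (Fin m → ℝ) → Equiv.Perm (Fin m))
    (hR_meas : ∀ m σ, MeasurableSet {z | R m z = σ})
    (hR : ∀ m z, FDX.IsRanking (T m z) (R m z))
    (ε : ℝ) (hε : 0 < ε) :
    ∃ r : ℕ → ℝ, Tendsto r atTop (𝓝 0) ∧
      ∀ m, (P m).real {ω | γ + ε ≤
          FDX.fdp (fun i => θ m i ω)
            (FDX.rejectionSet γ α (T m fun j => Z m j ω) (R m fun j => Z m j ω))}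
        ≤ α + r m := by
  open FDX in
  -- The remainder `r m` is the probability itself; it remains to show that it tends to `0`.
  refine ⟨_, ?_, fun m => le_add_of_nonneg_left hα₀.le⟩
  obtain ⟨γ', hγ', hp'⟩ := exists_lt_measure_lt_pos hpos
  have hlm := measurable_lfdr (π := π) hf₀ hf₁
  have hl := lfdr_mem_Icc hπ₀ hπ₁ hf₀ hf₁
  have : IsProbabilityMeasure (densityLaw (mixtureDensity π f₀ f₁)) := by
    rw [← (hmodel 1).map_Z hπ₀ hπ₁ hf₀ hf₁ 0]
    exact Measure.isProbabilityMeasure_map ((hmodel 1).measurable_Z 0).aemeasurable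
  set E : Set ℝ := {z | lfdr π f₀ f₁ z < γ'} with hEdef
  have hE : MeasurableSet E := measurableSet_lt hlm measurable_const
  obtain ⟨p, hp⟩ : ∃ p, (densityLaw (mixtureDensity π f₀ f₁)).real E = p := ⟨_, rfl⟩
  have hp₀ : 0 < p := hp ▸ ENNReal.toReal_pos hp'.ne' (measure_ne_top _ _)
  obtain ⟨δ, hδ₀, hδγ, hδε⟩ : ∃ δ : ℝ, 0 < δ ∧ δ ≤ (γ - γ') / 2 ∧ δ ≤ ε / 4 :=
    ⟨min ((γ - γ') / 2) (ε / 4), lt_min (half_pos (sub_pos.2 hγ')) (by positivity),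
      min_le_left _ _, min_le_right _ _⟩
  obtain ⟨b, hb₀, hbp, hbε⟩ : ∃ b : ℝ, 0 < b ∧ b ≤ p / 4 ∧ b ≤ ε / 4 * (p / 4) :=
    ⟨min (p / 4) (ε / 4 * (p / 4)), by positivity, min_le_left _ _, min_le_right _ _⟩
  set s : ℕ → ℝ := fun m => (⨆ i : Fin m,
    P m {ω | δ ≤ |T m (fun j => Z m j ω) i - lfdr π f₀ f₁ (Z m i ω)|}).toReal with hsdef
  have hs : Tendsto s atTop (𝓝 0) := by
    rw [← ENNReal.toReal_zero]
    exact (ENNReal.tendsto_toReal ENNReal.zero_ne_top).comp (hT_cons δ hδ₀)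
  have hlim : Tendsto (fun m : ℕ => (m : ℝ) / (p / 2 * m) ^ 2 + s m / b + m / (b * m) ^ 2)
      atTop (𝓝 0) := by
    simpa using ((tendsto_natCast_div_mul_sq (half_pos hp₀)).add (hs.div_const b)).add
      (tendsto_natCast_div_mul_sq hb₀)
  refine squeeze_zero' (Eventually.of_forall fun m => measureReal_nonneg) ?_ hlim
  have hlarge : ∀ a c : ℝ, 0 < a → ∀ᶠ m : ℕ in atTop, c < a * (p / 4 * m) := fun a c ha =>
    ((tendsto_natCast_atTop_atTop.const_mul_atTop (by positivity : 0 < p / 4)).const_mul_atTop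
      ha).eventually_gt_atTop c
  filter_upwards [eventually_gt_atTop 0,
    hlarge (α * ((γ - γ') / 2) ^ 2) 1
      (mul_pos hα₀ (pow_pos (half_pos (sub_pos.2 hγ')) 2)),
    hlarge ((1 - α) * (ε / 4) ^ 2) 1 (mul_pos (sub_pos.2 hα₁) (by positivity))]
    with m hm hm₁ hm₂
  have hZ : Measurable fun ω j => Z m j ω := measurable_pi_lambda _ (hmodel m).measurable_Z
  have hF : ∀ i : Fin m, MeasurableSet
      {ω | δ ≤ |T m (fun j => Z m j ω) i - lfdr π f₀ f₁ (Z m i ω)|} := fun i =>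
    measurableSet_le measurable_const
      ((((measurable_pi_apply i).comp ((hT_meas m).comp hZ)).sub
        (hlm.comp ((hmodel m).measurable_Z i))).abs)
  have h1 := (hmodel m).measureReal_card_filter_lt (q := fun z => lfdr π f₀ f₁ z < γ') hπ₀ hπ₁ hf₀ hf₁ hE hm hp₀ hp
  have h2 := measureReal_lt_card_filter_le (P := P m)
    (q := fun i ω => δ ≤ |T m (fun j => Z m j ω) i - lfdr π f₀ f₁ (Z m i ω)|) hF hb₀
    (fun i => ENNReal.toReal_mono
      (ne_top_of_le_ne_top ENNReal.one_ne_top (iSup_le fun i => prob_le_one))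
      (le_iSup (fun i : Fin m =>
        P m {ω | δ ≤ |T m (fun j => Z m j ω) i - lfdr π f₀ f₁ (Z m i ω)|}) i))
    ENNReal.toReal_nonneg
  have h3 := (hmodel m).measureReal_le_abs_sum_nullExcess hπ₀ hπ₁ hf₀ hf₁
    (measurableSet_mem_rejectionSet γ α (hT_meas m) (hR_meas m))
    (mul_pos hb₀ (Nat.cast_pos.2 hm))
  refine le_trans ?_ (add_le_add (add_le_add h1 h2) h3)
  -- Union bound over three events: too few small lfdr values, too many bad estimates, too large a
  -- fluctuation of the null count.
  refine le_trans (measureReal_mono fun ω hω => ?_)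
    ((measureReal_union_le _ _).trans (add_le_add (measureReal_union_le _ _) le_rfl))
  by_contra hgood
  rw [Set.mem_union, Set.mem_union, not_or, not_or] at hgood
  obtain ⟨⟨hN, hB⟩, hD⟩ := hgood
  exact (fdp_rejectionSet_lt hα₀ hα₁ hγ' hε hδ₀ hδγ hδε hbp hbε (hT_mem m _)
    (fun i => hl (Z m i ω)) (hR m _) (not_lt.1 hN) (not_lt.1 hB) (not_le.1 hD) hm₁.le
    hm₂).not_ge hω
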